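/- Let $n\ge 2$, let $I$ be a set with $n$ elements, and let $R_n=I\times\{1,2,3,\dots\}$, viewed as $n$ disjoint rays $\{i\}\times\{1,2,3,\dots\}$, $i\in I$. Let $\mathrm{Sym}(R_n)$ be the group of all permutations of $R_n$. The Houghton group $\mathcal H_n\le \mathrm{Sym}(R_n)$ consists of the permutations $\sigma$ for which there are an integer $N\ge 0$ and integers $t_i$ ($i\in I$) such that $\sigma(i,k)=(i,k+t_i)$ for all $i\in I$ and all $k\ge N$, $k\ge 1$. Let $\mathcal S_n$ be the symmetric group of $I$; each $s\in\mathcal S_n$ permutes the rays by $\hat s(i,k)=(s(i),k)$, and $\mathcal S_n$ acts on $\mathcal H_n$ by $s\cdot\sigma=\hat s\,\sigma\,\hat s^{-1}$. Then $\mathrm{Aut}(\mathcal H_n)$ is isomorphic to the semidirect product $\mathcal H_n\rtimes\mathcal S_n$ for this action. More precisely, there is an isomorphism $\mathcal H_n\rtimes\mathcal S_n\to\mathrm{Aut}(\mathcal H_n)$ that sends $h\in\mathcal H_n$ to conjugation by $h$ and $s\in\mathcal S_n$ to conjugation by $\hat s$. Moreover, every $\alpha\in\mathrm{Sym}(R_n)$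 that normalizes $\mathcal H_n$ eventually maps rays to rays by translations: there is a permutation $\pi$ of $I$ such that for every $i\in I$ there are integers $k,l\ge 1$ with $\alpha(i,k+m)=(\pi(i),l+m)$ for all $m\ge 0$. -/

import Mathlib

/-- `n` disjoint rays: the vertex `(i, k)` is the `k`-th point (`k ≥ 1`) of the `i`-th ray. -/
abbrev Rays (n : ℕ) : Type := Fin n × ℕ+

/-- `σ` is eventually a translation on each ray: there are an `N` and integers `t i` with
`σ (i, k) = (i, k + t i)` for all `i` and all `k ≥ N`. -/
def EventuallyTranslation {n : ℕ} (σ : Equiv.Perm (Rays n)) : Prop :=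
  ∃ (N : ℕ) (t : Fin n → ℤ), ∀ (i : Fin n) (k : ℕ+), N ≤ (k : ℕ) →
    (σ (i, k)).1 = i ∧ (((σ (i, k)).2 : ℕ) : ℤ) = ((k : ℕ) : ℤ) + t i

theorem EventuallyTranslation.one {n : ℕ} :
    EventuallyTranslation (1 : Equiv.Perm (Rays n)) :=
  ⟨0, fun _ => 0, fun i k _ => by simp⟩

theorem EventuallyTranslation.mul {n : ℕ} {σ τ : Equiv.Perm (Rays n)}
    (hσ : EventuallyTranslation σ) (hτ : EventuallyTranslation τ) :
    EventuallyTranslation (σ * τ) := by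
  obtain ⟨N, t, h⟩ := hσ
  obtain ⟨M, s, g⟩ := hτ
  refine ⟨M + N + Finset.univ.sup (fun i => (s i).natAbs), fun i => s i + t i, ?_⟩
  intro i k hk
  have hs : (s i).natAbs ≤ Finset.univ.sup (fun i => (s i).natAbs) :=
    Finset.le_sup (f := fun i => (s i).natAbs) (Finset.mem_univ i)
  obtain ⟨g1, g2⟩ := g i k (by omega)
  have e : τ (i, k) = (i, (τ (i, k)).2) := Prod.ext g1 rfl
  obtain ⟨h1, h2⟩ := h i (τ (i, k)).2 (by omega)
  rw [Equiv.Perm.mul_apply, e]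
  exact ⟨h1, by dsimp only; omega⟩

theorem EventuallyTranslation.inv {n : ℕ} {σ : Equiv.Perm (Rays n)}
    (hσ : EventuallyTranslation σ) : EventuallyTranslation σ⁻¹ := by
  obtain ⟨N, t, h⟩ := hσ
  refine ⟨N + 1 + Finset.univ.sup (fun i => (t i).natAbs), fun i => - t i, ?_⟩
  intro i k hk
  have hs : (t i).natAbs ≤ Finset.univ.sup (fun i => (t i).natAbs) :=
    Finset.le_sup (f := fun i => (t i).natAbs) (Finset.mem_univ i)
  obtain ⟨m, hm⟩ : ∃ m : ℕ+, ((m : ℕ) : ℤ) = (k : ℕ) - t i :=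
    ⟨⟨(((k : ℕ) : ℤ) - t i).toNat, by omega⟩, by
      rw [PNat.mk_coe]; omega⟩
  obtain ⟨h1, h2⟩ := h i m (by omega)
  have e : σ (i, m) = (i, k) := Prod.ext h1 (PNat.eq (by dsimp only; omega))
  have e' : σ⁻¹ (i, k) = (i, m) := by rw [Equiv.Perm.inv_eq_iff_eq, e]
  rw [e']
  exact ⟨rfl, by dsimp only; omega⟩

/-- The Houghton group `H_n`, as a subgroup of the symmetric group of the set of all vertices. -/
def houghton (n : ℕ) : Subgroup (Equiv.Perm (Rays n)) where
  carrier := {σ | EventuallyTranslation σ}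
  one_mem' := EventuallyTranslation.one
  mul_mem' := EventuallyTranslation.mul
  inv_mem' := EventuallyTranslation.inv

/-- The symmetric group of the index set permutes the rays: `s` maps `(i, k)` to `(s i, k)`. -/
def rayPerm (n : ℕ) : Equiv.Perm (Fin n) →* Equiv.Perm (Rays n) where
  toFun s := Equiv.prodCongr s (Equiv.refl ℕ+)
  map_one' := rfl
  map_mul' _ _ := rfl

theorem rayPerm_conj_mem {n : ℕ} (s : Equiv.Perm (Fin n)) {σ : Equiv.Perm (Rays n)}
    (hσ : σ ∈ houghton n) : rayPerm n s * σ * (rayPerm n s)⁻¹ ∈ houghton n := by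
  obtain ⟨N, t, h⟩ := hσ
  refine ⟨N, fun i => t (s⁻¹ i), fun i k hk => ?_⟩
  obtain ⟨h1, h2⟩ := h (s⁻¹ i) k hk
  have e : (rayPerm n s)⁻¹ (i, k) = (s⁻¹ i, k) := rfl
  rw [Equiv.Perm.mul_apply, Equiv.Perm.mul_apply, e]
  refine ⟨?_, h2⟩
  change s (σ (s⁻¹ i, k)).1 = i
  rw [h1]
  exact s.apply_symm_apply i

theorem rayPerm_mem_normalizer {n : ℕ} (s : Equiv.Perm (Fin n)) :
    rayPerm n s ∈ Subgroup.normalizer (houghton n : Set (Equiv.Perm (Rays n))) := by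
  rw [Subgroup.mem_normalizer_iff]
  refine fun σ => ⟨rayPerm_conj_mem s, fun h => ?_⟩
  have := rayPerm_conj_mem s⁻¹ h
  rw [map_inv] at this
  simpa [mul_assoc] using this

/-- The action of the symmetric group on `H_n` that defines the semidirect product:
`s` acts as conjugation by `rayPerm n s`. -/
def rayAction (n : ℕ) : Equiv.Perm (Fin n) →* MulAut (houghton n) :=
  (houghton n).normalizerMonoidHom.comp
    ((rayPerm n).codRestrict
      (Subgroup.normalizer (houghton n : Set (Equiv.Perm (Rays n)))) rayPerm_mem_normalizer)

theorem rayAction_apply (n : ℕ) (s : Equiv.Perm (Fin n)) (h : houghton n) :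
    (rayAction n s h : Equiv.Perm (Rays n)) = rayPerm n s * h * (rayPerm n s)⁻¹ :=
  rfl

/-! The group contains every transposition of the infinite set of vertices, and transpositions are
recognisable inside it: they are the involutions whose product with every conjugate has order
dividing 6 (`isSixTransposition_swap`, `IsSixTransposition.isSwap`). An automorphism therefore
permutes the transpositions. It maps the star of transpositions at a point to a star, hence induces
a map of points, and is conjugation by that permutation `α` (`exists_perm_conj_eq`).

Such an `α` normalizes the group, so it conjugates the unit shift along a line of two rays to an
element of the group. The one infinite orbit of this conjugate holds all its moved points, which
forces the orbit to run eventually along a ray in unit steps (`exists_ray_of_orbit`). So `α`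
permutes rays up to translation, and factors as `h * rayPerm n s`. Only the identity centralizes all
transpositions, and only the trivial `rayPerm` lies in the group; this gives injectivity. -/

/-! ### Transpositions characterised by the group structure -/

open Equiv in
-- Disjoint transpositions commute, giving order dividing 2; with one common point the product is a
-- 3-cycle.
theorem Equiv.Perm.swap_mul_swap_pow_six {X : Type*} [DecidableEq X] (a b c d : X) :
    (swap a b * swap c d) ^ 6 = 1 := by
  have key : ∀ a b c : X, (swap a b * swap a c) ^ 6 = 1 := by
    intro a b c
    by_cases hab : a = b
    · subst hab; rw [swap_self, ← Perm.one_def, one_mul]; simp [pow_succ]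
    by_cases hac : a = c
    · subst hac; rw [swap_self, ← Perm.one_def, mul_one]; simp [pow_succ]
    by_cases hbc : b = c
    · subst hbc; simp
    have h1 : swap a b * swap a c * swap a b = swap b c := by
      have := swap_apply_apply (swap a b) a c
      rw [swap_apply_left, swap_apply_of_ne_of_ne (Ne.symm hac) (Ne.symm hbc), swap_inv] at this
      exact this.symm
    have h2 : swap a c * swap a b * swap a c = swap b c := by
      have := swap_apply_apply (swap a c) a b
      rw [swap_apply_left, swap_apply_of_ne_of_ne (Ne.symm hab) hbc, swap_inv] at this
      rw [swap_comm b c]; exact this.symm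
    have h3 : (swap a b * swap a c) ^ 3 = 1 := by
      calc (swap a b * swap a c) ^ 3
          = (swap a b * swap a c * swap a b) * (swap a c * swap a b * swap a c) := by
            simp only [pow_succ, pow_zero, one_mul, mul_assoc]
        _ = 1 := by rw [h1, h2, swap_mul_self]
    rw [show 6 = 3 * 2 from rfl, pow_mul, h3, one_pow]
  by_cases hac : a = c
  · subst hac; exact key a b d
  by_cases had : a = d
  · subst had; rw [swap_comm c a]; exact key a b c
  by_cases hbc : b = c
  · subst hbc; rw [swap_comm a b]; exact key b a d
  by_cases hbd : b = d
  · subst hbd; rw [swap_comm a b, swap_comm c b]; exact key b a c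
  have hc : Commute (swap a b) (swap c d) := by
    refine Perm.Disjoint.commute fun x => ?_
    by_cases hxa : x = a
    · right; subst hxa; exact swap_apply_of_ne_of_ne hac had
    by_cases hxb : x = b
    · right; subst hxb; exact swap_apply_of_ne_of_ne hbc hbd
    left; exact swap_apply_of_ne_of_ne hxa hxb
  rw [hc.mul_pow]
  simp [pow_succ]

/-- An involution whose product with any of its conjugates has order dividing `6`. -/
def IsSixTransposition {G : Type*} [Group G] (t : G) : Prop :=
  t ≠ 1 ∧ t * t = 1 ∧ ∀ g, (t * (g * t * g⁻¹)) ^ 6 = 1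

theorem IsSixTransposition.map {G H : Type*} [Group G] [Group H] (φ : G ≃* H) {t : G}
    (ht : IsSixTransposition t) : IsSixTransposition (φ t) := by
  obtain ⟨h1, h2, h3⟩ := ht
  refine ⟨by simpa using h1, by rw [← map_mul, h2, map_one], fun g => ?_⟩
  obtain ⟨g, rfl⟩ := φ.surjective g
  rw [← map_inv, ← map_mul, ← map_mul, ← map_mul, ← map_pow, h3, map_one]

theorem Equiv.Perm.eq_swap_of_isSwap {X : Type*} [DecidableEq X] {t : Equiv.Perm X}
    (ht : t.IsSwap) {p q : X} (hpq : p ≠ q) (hp : t p ≠ p) (hq : t q ≠ q) :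
    t = Equiv.swap p q := by
  obtain ⟨x, y, hxy, rfl⟩ := ht
  have hp' : p = x ∨ p = y := by
    by_contra! h; exact hp (Equiv.swap_apply_of_ne_of_ne h.1 h.2)
  have hq' : q = x ∨ q = y := by
    by_contra! h; exact hq (Equiv.swap_apply_of_ne_of_ne h.1 h.2)
  rcases hp' with rfl | rfl <;> rcases hq' with rfl | rfl
  · exact absurd rfl hpq
  · rfl
  · exact Equiv.swap_comm _ _
  · exact absurd rfl hpq

theorem Equiv.Perm.eq_swap_apply_of_isSwap {X : Type*} [DecidableEq X] {t : Equiv.Perm X}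
    (ht : t.IsSwap) {p : X} (hp : t p ≠ p) : t = Equiv.swap p (t p) :=
  Equiv.Perm.eq_swap_of_isSwap ht hp.symm hp fun h => hp (t.injective h)

theorem exists_ne_of_infinite {X : Type*} [Infinite X] (l : List X) : ∃ x, x ∉ l := by
  classical
  obtain ⟨x, hx⟩ := Infinite.exists_notMem_finset l.toFinset
  exact ⟨x, by simpa using hx⟩

section SwapSubgroup

variable {X : Type*} [DecidableEq X] {G : Subgroup (Equiv.Perm X)}

open Equiv

theorem isSixTransposition_swap (hG : ∀ a b : X, swap a b ∈ G) {a b : X} (hab : a ≠ b) :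
    IsSixTransposition (⟨swap a b, hG a b⟩ : G) := by
  refine ⟨fun h => hab ?_, Subtype.ext (swap_mul_self a b), fun g => Subtype.ext ?_⟩
  · have := congrArg Subtype.val h
    exact swap_eq_one_iff.1 this
  · change (swap a b * ((g : Perm X) * swap a b * (g : Perm X)⁻¹)) ^ 6 = 1
    rw [← swap_apply_apply]
    exact Perm.swap_mul_swap_pow_six _ _ _ _

/-- An involution with two 2-cycles `(a b)`, `(c d)` has a conjugate such that the product contains
a 5-cycle (if there is a fixed point) or a 4-cycle (if there is none); neither length divides 6. -/
theorem IsSixTransposition.isSwap [Infinite X] (hG : ∀ a b : X, swap a b ∈ G) {t : G}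
    (ht : IsSixTransposition t) : (t : Perm X).IsSwap := by
  obtain ⟨h1, h2, h3⟩ := ht
  obtain ⟨t, htG⟩ := t
  have hinv : ∀ x, t (t x) = x := fun x => by
    have := congrArg Subtype.val h2
    exact congrArg (fun f : Perm X => f x) this
  have h6 : ∀ g ∈ G, ∃ u : Perm X, (∀ x, u (u (u (u (u (u x))))) = x) ∧
      ∀ p q r s, g q = p → t q = r → g r = s → u p = t s := fun g hg => by
    refine ⟨t * (g * t * g⁻¹), fun x => ?_, ?_⟩
    · have := congrArg Subtype.val (h3 ⟨g, hg⟩)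
      exact congrArg (fun f : Perm X => f x) this
    · rintro p q r s rfl rfl rfl
      simp
  obtain ⟨a, hab⟩ : ∃ a, t a ≠ a := by
    by_contra! h; exact h1 (Subtype.ext (Equiv.ext h))
  obtain ⟨b, hb⟩ : ∃ b, b = t a := ⟨_, rfl⟩
  have hta : t a = b := hb.symm
  have htb : t b = a := by rw [hb, hinv]
  rw [hta] at hab
  refine ⟨a, b, hab.symm, ?_⟩
  by_contra hne
  obtain ⟨c, hc⟩ : ∃ c, t c ≠ swap a b c := by
    by_contra! h; exact hne (Equiv.ext h)
  have hca : c ≠ a := by rintro rfl; exact hc (by simp [hta])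
  have hcb : c ≠ b := by rintro rfl; exact hc (by simp [htb])
  rw [swap_apply_of_ne_of_ne hca hcb] at hc
  obtain ⟨d, hd⟩ : ∃ d, d = t c := ⟨_, rfl⟩
  have htc : t c = d := hd.symm
  have htd : t d = c := by rw [hd, hinv]
  rw [htc] at hc
  have hda : d ≠ a := by rintro rfl; exact hcb (htd.symm.trans hta)
  have hdb : d ≠ b := by rintro rfl; exact hca (htd.symm.trans htb)
  by_cases hfix : ∃ e, t e = e
  · obtain ⟨e, he⟩ := hfix
    have hea : e ≠ a := by rintro rfl; exact hab (hta.symm.trans he)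
    have heb : e ≠ b := by rintro rfl; exact hab (he.symm.trans htb)
    have hec : e ≠ c := by rintro rfl; exact hc (htc.symm.trans he)
    have hed : e ≠ d := by rintro rfl; exact hc (he.symm.trans htd)
    -- The conjugate acts as `(a c)(b e)` and fixes `d`; the product with `t` has the 5-cycle `a d c
    -- b e`.
    obtain ⟨u, h6, hu⟩ := h6 (swap b c * swap d e) (G.mul_mem (hG _ _) (hG _ _))
    simp only [Perm.mul_apply] at hu
    have ga : swap b c (swap d e a) = a := by grind
    have gb : swap b c (swap d e b) = c := by grind
    have gc : swap b c (swap d e c) = b := by grind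
    have gd : swap b c (swap d e d) = e := by grind
    have ge : swap b c (swap d e e) = d := by grind
    have u1 : u a = d := (hu _ _ _ _ ga hta gb).trans htc
    have u2 : u d = c := (hu _ _ _ _ ge he ge).trans htd
    have u3 : u c = b := (hu _ _ _ _ gb htb ga).trans hta
    have u4 : u b = e := (hu _ _ _ _ gc htc gd).trans he
    have u5 : u e = a := (hu _ _ _ _ gd htd gc).trans htb
    have := h6 a
    rw [u1, u2, u3, u4, u5, u1] at this
    exact hda this
  · push Not at hfix
    obtain ⟨e, he⟩ := exists_ne_of_infinite [a, b, c, d]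
    simp only [List.mem_cons, List.not_mem_nil, or_false, not_or] at he
    obtain ⟨hea, heb, hec, hed⟩ := he
    obtain ⟨f, hf⟩ : ∃ f, f = t e := ⟨_, rfl⟩
    have hte : t e = f := hf.symm
    have htf : t f = e := by rw [hf, hinv]
    have hfe : f ≠ e := by rw [hf]; exact hfix e
    have hfa : f ≠ a := by rintro rfl; exact heb (htf.symm.trans hta)
    have hfb : f ≠ b := by rintro rfl; exact hea (htf.symm.trans htb)
    have hfc : f ≠ c := by rintro rfl; exact hed (htf.symm.trans htc)
    have hfd : f ≠ d := by rintro rfl; exact hec (htf.symm.trans htd)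
    obtain ⟨x, hx⟩ := exists_ne_of_infinite [a, b, c, d, e, f]
    simp only [List.mem_cons, List.not_mem_nil, or_false, not_or] at hx
    obtain ⟨hxa, hxb, hxc, hxd, hxe, hxf⟩ := hx
    obtain ⟨y, hy⟩ : ∃ y, y = t x := ⟨_, rfl⟩
    have htx : t x = y := hy.symm
    have hty : t y = x := by rw [hy, hinv]
    have hyx : y ≠ x := by rw [hy]; exact hfix x
    have hya : y ≠ a := by rintro rfl; exact hxb (hty.symm.trans hta)
    have hyb : y ≠ b := by rintro rfl; exact hxa (hty.symm.trans htb)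
    have hyc : y ≠ c := by rintro rfl; exact hxd (hty.symm.trans htc)
    have hyd : y ≠ d := by rintro rfl; exact hxc (hty.symm.trans htd)
    have hye : y ≠ e := by rintro rfl; exact hxf (hty.symm.trans hte)
    have hyf : y ≠ f := by rintro rfl; exact hxe (hty.symm.trans htf)
    -- The conjugate acts as `(a c)(b e)(d x)(f y)`; the product has the 4-cycle `a d y e`.
    obtain ⟨u, h6, hu⟩ := h6 (swap b c * swap d e * swap f x)
      (G.mul_mem (G.mul_mem (hG _ _) (hG _ _)) (hG _ _))
    simp only [Perm.mul_apply] at hu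
    clear hb hd hf hy hfix h3 h2 h1 hne hinv
    have ga : swap b c (swap d e (swap f x a)) = a := by grind
    have gb : swap b c (swap d e (swap f x b)) = c := by grind
    have gc : swap b c (swap d e (swap f x c)) = b := by grind
    have gd : swap b c (swap d e (swap f x d)) = e := by grind
    have ge : swap b c (swap d e (swap f x e)) = d := by grind
    have gf : swap b c (swap d e (swap f x f)) = x := by grind
    have gx : swap b c (swap d e (swap f x x)) = f := by grind
    have gy : swap b c (swap d e (swap f x y)) = y := by grind
    have u1 : u a = d := (hu _ _ _ _ ga hta gb).trans htc
    have u2 : u d = y := (hu _ _ _ _ ge hte gf).trans htx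
    have u3 : u y = e := (hu _ _ _ _ gy hty gx).trans htf
    have u4 : u e = a := (hu _ _ _ _ gd htd gc).trans htb
    have := h6 a
    rw [u1, u2, u3, u4, u1, u2] at this
    exact hya this

/-! ### From automorphisms to permutations of points -/

/-- If `f a ≠ g a`, then `f a = g b` for every `b ≠ a`, so `g` takes one value at two such points
and a transposition would be trivial. -/
theorem eq_of_swap_eq_swap [Infinite X] {f g : X → X} (hf : Function.Injective f)
    (h : ∀ a b, a ≠ b → swap (f a) (f b) = swap (g a) (g b)) : f = g := by
  funext a
  by_contra hne
  have key : ∀ b, b ≠ a → f a = g b := by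
    intro b hb
    by_contra hab
    have h1 : swap (f a) (f b) (f a) = f b := swap_apply_left _ _
    rw [h a b hb.symm, swap_apply_of_ne_of_ne hne hab] at h1
    exact hb (hf h1).symm
  obtain ⟨b, hb⟩ := exists_ne_of_infinite [a]
  obtain ⟨c, hc⟩ := exists_ne_of_infinite [a, b]
  simp only [List.mem_cons, List.not_mem_nil, or_false, not_or] at hb hc
  have h1 := h b c (Ne.symm hc.2)
  rw [← key b hb, ← key c hc.1, swap_self] at h1
  exact hc.2 (hf (swap_eq_one_iff.1 h1)).symm

/-- The image under `φ` of the star of transpositions at a point is a star. -/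
theorem exists_star_center [Infinite X] (hG : ∀ a b : X, swap a b ∈ G) (φ : MulAut G) (a : X) :
    ∃ p, ∀ x, x ≠ a → (φ ⟨swap a x, hG a x⟩ : Perm X) p ≠ p := by
  set σ : X → X → Perm X := fun a b => (φ ⟨swap a b, hG a b⟩ : Perm X) with hσ
  have hswap : ∀ {a b}, a ≠ b → (σ a b).IsSwap := fun hab =>
    ((isSixTransposition_swap hG hab).map φ).isSwap hG
  have hinj : ∀ {a b c d}, σ a b = σ c d → swap a b = swap c d := fun h =>
    congrArg Subtype.val (φ.injective (Subtype.ext h))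
  have hcomm : ∀ {b c}, b ≠ a → c ≠ a → b ≠ c → ¬ Commute (σ a b) (σ a c) := by
    intro b c hb hc hbc h
    have h1 : φ (⟨swap a b, hG a b⟩ * ⟨swap a c, hG a c⟩)
        = φ (⟨swap a c, hG a c⟩ * ⟨swap a b, hG a b⟩) := by
      rw [map_mul, map_mul]; exact Subtype.ext h
    have h2 := congrArg (fun f : G => (f : Perm X) a) (φ.injective h1)
    simp only [Subgroup.coe_mul, Perm.mul_apply, swap_apply_left] at h2
    rw [swap_apply_of_ne_of_ne hc hbc.symm, swap_apply_of_ne_of_ne hb hbc] at h2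
    exact hbc h2.symm
  have hmeet : ∀ {b c}, b ≠ a → c ≠ a → b ≠ c → ∃ p, σ a b p ≠ p ∧ σ a c p ≠ p := by
    intro b c hb hc hbc
    by_contra! h
    exact hcomm hb hc hbc (Perm.Disjoint.commute fun x => or_iff_not_imp_left.2 (h x))
  obtain ⟨b, hb⟩ := exists_ne_of_infinite [a]
  obtain ⟨c, hc⟩ := exists_ne_of_infinite [a, b]
  simp only [List.mem_cons, List.not_mem_nil, or_false, not_or] at hb hc
  obtain ⟨hca, hcb⟩ := hc
  obtain ⟨p, hpb, hpc⟩ := hmeet hb hca (Ne.symm hcb)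
  refine ⟨p, fun x hx => ?_⟩
  change σ a x p ≠ p
  by_cases hxb : x = b
  · rwa [hxb]
  by_cases hxc : x = c
  · rwa [hxc]
  -- Pairwise meeting edges without a common point form a triangle `p q r`. Its third edge is also
  -- the image of `swap b c`, so `swap a x = swap b c`, which is impossible.
  intro hxp
  obtain ⟨q, hq1, hq2⟩ := hmeet hx hb hxb
  obtain ⟨r, hr1, hr2⟩ := hmeet hx hca hxc
  have hqp : p ≠ q := by rintro rfl; exact hq1 hxp
  have hrp : p ≠ r := by rintro rfl; exact hr1 hxp
  have e1 : σ a b = swap p q := Perm.eq_swap_of_isSwap (hswap (Ne.symm hb)) hqp hpb hq2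
  have e2 : σ a c = swap p r := Perm.eq_swap_of_isSwap (hswap (Ne.symm hca)) hrp hpc hr2
  have hqr : q ≠ r := by
    rintro rfl
    exact hcomm hb hca (Ne.symm hcb) (by rw [e1, e2])
  have e3 : σ a x = swap q r := Perm.eq_swap_of_isSwap (hswap (Ne.symm hx)) hqr hq1 hr1
  have e4 : σ b c = swap q r := by
    have h1 : swap b c = swap a b * swap a c * swap a b := by
      have := swap_apply_apply (swap a b) a c
      rwa [swap_apply_left, swap_apply_of_ne_of_ne hca hcb, swap_inv] at this
    have h2 : swap q r = swap p q * swap p r * swap p q := by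
      have := swap_apply_apply (swap p q) p r
      rwa [swap_apply_left, swap_apply_of_ne_of_ne (Ne.symm hrp) (Ne.symm hqr), swap_inv] at this
    have h3 : (⟨swap b c, hG b c⟩ : G)
        = ⟨swap a b, hG a b⟩ * ⟨swap a c, hG a c⟩ * ⟨swap a b, hG a b⟩ := Subtype.ext h1
    rw [h2, ← e1, ← e2]
    simp only [hσ]
    rw [h3, map_mul, map_mul]
    rfl
  have h5 := hinj (e3.trans e4.symm)
  have h6 : swap a x a = x := swap_apply_left _ _
  rw [h5, swap_apply_of_ne_of_ne (Ne.symm hb) (Ne.symm hca)] at h6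
  exact hx h6.symm

theorem exists_pointMap [Infinite X] (hG : ∀ a b : X, swap a b ∈ G) (φ : MulAut G) :
    ∃ α : X → X, Function.Injective α ∧
      ∀ a b, a ≠ b → (φ ⟨swap a b, hG a b⟩ : Perm X) = swap (α a) (α b) := by
  choose α hα using exists_star_center hG φ
  have hswap : ∀ {a b}, a ≠ b → (φ ⟨swap a b, hG a b⟩ : Perm X).IsSwap := fun hab =>
    ((isSixTransposition_swap hG hab).map φ).isSwap hG
  have hα' : ∀ a b, a ≠ b → (φ ⟨swap a b, hG a b⟩ : Perm X) (α b) ≠ α b := by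
    intro a b hab
    have := hα b a hab
    simpa only [swap_comm b a] using this
  have hinj : Function.Injective α := by
    intro a b h
    by_contra hab
    obtain ⟨c, hc⟩ := exists_ne_of_infinite [a, b]
    simp only [List.mem_cons, List.not_mem_nil, or_false, not_or] at hc
    obtain ⟨hca, hcb⟩ := hc
    have e1 := Perm.eq_swap_apply_of_isSwap (hswap hab) (hα a b (Ne.symm hab))
    have e2 := Perm.eq_swap_apply_of_isSwap (hswap (Ne.symm hca)) (hα a c hca)
    have n1 := hα a b (Ne.symm hab)
    have n2 := hα a c hca
    have n3 := hα b c hcb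
    set p := α a
    set u := (φ ⟨swap a b, hG a b⟩ : Perm X) p
    set v := (φ ⟨swap a c, hG a c⟩ : Perm X) p
    -- With a common centre `p`, the images of `swap a b` and `swap a c` are `(p u)` and `(p v)`, so
    -- that of `swap b c` is `(u v)`, which fixes `p`.
    have huv : u ≠ v := by
      intro huv
      rw [huv, ← e2] at e1
      have := congrArg Subtype.val (φ.injective (Subtype.ext e1))
      have h6 : swap a b a = b := swap_apply_left _ _
      rw [show swap a b = swap a c from this, swap_apply_left] at h6
      exact hcb h6
    have h1 : swap b c = swap a b * swap a c * swap a b := by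
      have := swap_apply_apply (swap a b) a c
      rwa [swap_apply_left, swap_apply_of_ne_of_ne hca hcb, swap_inv] at this
    have h3 : (⟨swap b c, hG b c⟩ : G)
        = ⟨swap a b, hG a b⟩ * ⟨swap a c, hG a c⟩ * ⟨swap a b, hG a b⟩ := Subtype.ext h1
    rw [← h, h3, map_mul, map_mul, Subgroup.coe_mul, Subgroup.coe_mul, e1, e2] at n3
    simp only [Perm.mul_apply, swap_apply_left] at n3
    rw [swap_apply_of_ne_of_ne n1 huv, swap_apply_right] at n3
    exact n3 rfl
  exact ⟨α, hinj, fun a b hab => Perm.eq_swap_of_isSwap (hswap hab) (hinj.ne hab)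
    (hα a b (Ne.symm hab)) (hα' a b hab)⟩

/-- Every automorphism of a permutation group of an infinite set that contains all
transpositions is induced by a permutation of the set. -/
theorem exists_perm_conj_eq [Infinite X] (hG : ∀ a b : X, swap a b ∈ G) (φ : MulAut G) :
    ∃ α : Perm X, ∀ g : G, (φ g : Perm X) = α * g * α⁻¹ := by
  obtain ⟨α, hα, h⟩ := exists_pointMap hG φ
  obtain ⟨β, hβ, h'⟩ := exists_pointMap hG φ⁻¹
  have e1 : id = α ∘ β := eq_of_swap_eq_swap Function.injective_id fun a b hab => by
    have h2 : φ⁻¹ ⟨swap a b, hG a b⟩ = ⟨swap (β a) (β b), hG _ _⟩ := Subtype.ext (h' a b hab)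
    have := h (β a) (β b) (hβ.ne hab)
    rw [← h2, MulAut.apply_inv_self] at this
    exact this
  have e2 : id = β ∘ α := eq_of_swap_eq_swap Function.injective_id fun a b hab => by
    have h2 : φ ⟨swap a b, hG a b⟩ = ⟨swap (α a) (α b), hG _ _⟩ := Subtype.ext (h a b hab)
    have := h' (α a) (α b) (hα.ne hab)
    rw [← h2, MulAut.inv_apply_self] at this
    exact this
  refine ⟨⟨α, β, fun x => (congrFun e2 x).symm, fun x => (congrFun e1 x).symm⟩, fun g => ?_⟩
  rw [eq_mul_inv_iff_mul_eq]
  have key : (fun x => (φ g : Perm X) (α x)) = fun x => α ((g : Perm X) x) := by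
    refine eq_of_swap_eq_swap ((φ g : Perm X).injective.comp hα) fun a b hab => ?_
    rw [← h _ _ ((g : Perm X).injective.ne hab), swap_apply_apply, ← h a b hab]
    have : (⟨swap ((g : Perm X) a) ((g : Perm X) b), hG _ _⟩ : G)
        = g * ⟨swap a b, hG a b⟩ * g⁻¹ := Subtype.ext (swap_apply_apply _ _ _)
    rw [this, map_mul, map_mul, map_inv]
    rfl
  exact Equiv.ext fun x => congrFun key x

end SwapSubgroup

/-! ### Shifts along lines of two rays -/

section Houghton

variable {n : ℕ}

theorem swap_mem_houghton (a b : Rays n) : Equiv.swap a b ∈ houghton n := by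
  refine ⟨(a.2 : ℕ) + b.2 + 1, fun _ => 0, fun i k hk => ?_⟩
  rw [Equiv.swap_apply_of_ne_of_ne]
  · simp
  · rintro rfl; dsimp only at hk; omega
  · rintro rfl; dsimp only at hk; omega

/-- The line formed by the rays `j` (reversed) and `i`. -/
def rayLine {i j : Fin n} (hij : i ≠ j) : ℤ ↪ Rays n where
  -- Both arguments of `toPNat'` are positive, so its default value never occurs.
  toFun s := if 1 ≤ s then (i, s.toNat.toPNat') else (j, (1 - s).toNat.toPNat')
  inj' s t h := by
    have hc := congrArg (fun x : Rays n => (x.2 : ℕ)) h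
    have h1 := congrArg Prod.fst h
    dsimp only at hc h1
    split_ifs at hc h1 with hs ht ht
    · simp only [Nat.toPNat'_coe] at hc
      split_ifs at hc <;> omega
    · exact absurd h1 hij
    · exact absurd h1.symm hij
    · simp only [Nat.toPNat'_coe] at hc
      split_ifs at hc <;> omega

theorem rayLine_of_pos {i j : Fin n} (hij : i ≠ j) (k : ℕ+) :
    rayLine hij (k : ℕ) = (i, k) := by
  have hk := k.pos
  change (if 1 ≤ ((k : ℕ) : ℤ) then _ else _) = _
  rw [if_pos (by omega)]
  exact Prod.ext rfl (PNat.eq (by simp))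

theorem rayLine_of_nonpos {i j : Fin n} (hij : i ≠ j) (k : ℕ+) :
    rayLine hij (1 - (k : ℕ)) = (j, k) := by
  have hk := k.pos
  change (if 1 ≤ 1 - ((k : ℕ) : ℤ) then _ else _) = _
  rw [if_neg (by omega)]
  exact Prod.ext rfl (PNat.eq (by simp))

/-- The translation by one along the line formed by the rays `j` and `i`. -/
noncomputable def rayShift {i j : Fin n} (hij : i ≠ j) : Equiv.Perm (Rays n) :=
  Equiv.Perm.viaEmbedding (Equiv.addRight (1 : ℤ)) (rayLine hij)

theorem rayShift_rayLine {i j : Fin n} (hij : i ≠ j) (s : ℤ) :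
    rayShift hij (rayLine hij s) = rayLine hij (s + 1) :=
  Equiv.Perm.viaEmbedding_apply _ _ _

theorem rayShift_of_notMem {i j : Fin n} (hij : i ≠ j) {x : Rays n}
    (hx : x ∉ Set.range (rayLine hij)) : rayShift hij x = x :=
  Equiv.Perm.viaEmbedding_apply_of_notMem _ _ _ hx

theorem rayShift_mem_houghton {i j : Fin n} (hij : i ≠ j) : rayShift hij ∈ houghton n := by
  -- The bound is 2 because `(j, 1)` leaves its ray, moving to `(i, 1)`.
  refine ⟨2, fun r => if r = i then 1 else if r = j then -1 else 0, fun r k hk => ?_⟩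
  by_cases hri : r = i
  · subst hri
    have : rayShift hij (r, k) = (r, k + 1) := by
      rw [← rayLine_of_pos hij, rayShift_rayLine, ← rayLine_of_pos hij]
      simp
    rw [this]
    simp
  by_cases hrj : r = j
  · subst hrj
    obtain ⟨l, hl⟩ : ∃ l : ℕ+, (l : ℕ) + 1 = k := ⟨⟨(k : ℕ) - 1, by omega⟩, by
      rw [PNat.mk_coe]; omega⟩
    have : rayShift hij (r, k) = (r, l) := by
      rw [← rayLine_of_nonpos hij, rayShift_rayLine, ← rayLine_of_nonpos hij, ← hl]
      congr 1
      push_cast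
      ring
    rw [this]
    simp only [if_neg hri, if_true, true_and]
    omega
  · rw [rayShift_of_notMem]
    · simp [hri, hrj]
    · rintro ⟨s, hs⟩
      have h1 := congrArg Prod.fst hs
      change (if 1 ≤ s then _ else _ : Rays n).1 = r at h1
      split_ifs at h1
      · exact hri h1.symm
      · exact hrj h1.symm

/-- A bi-infinite orbit of an element of the Houghton group that contains every moved point
runs, from some point on, along a ray in steps of length one. -/
theorem exists_ray_of_orbit {h : Equiv.Perm (Rays n)} (hh : h ∈ houghton n) {y : ℤ → Rays n}
    (hy : Function.Injective y) (hstep : ∀ s, h (y s) = y (s + 1))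
    (hmoved : ∀ z, h z ≠ z → z ∈ Set.range y) :
    ∃ (r : Fin n) (k l : ℕ+), ∀ m : ℕ, (y ((k : ℕ) + m)).1 = r ∧
      ((y ((k : ℕ) + m)).2 : ℕ) = l + m := by
  obtain ⟨N, t, ht⟩ := hh
  have hfin : {x : Rays n | (x.2 : ℕ) < N}.Finite := by
    have : {x : Rays n | (x.2 : ℕ) < N} ⊆ Set.univ ×ˢ ((fun k : ℕ+ => (k : ℕ)) ⁻¹' Set.Iio N) :=
      fun x hx => ⟨trivial, hx⟩
    exact (Set.finite_univ.prod ((Set.finite_Iio N).preimage PNat.coe_injective.injOn)).subset this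
  obtain ⟨B, hB⟩ := (hfin.preimage hy.injOn).bddAbove
  obtain ⟨k, hk⟩ : ∃ k : ℕ+, B < (k : ℕ) := ⟨⟨B.toNat + 1, by omega⟩, by
    rw [PNat.mk_coe]; omega⟩
  have hfar : ∀ m : ℕ, N ≤ ((y ((k : ℕ) + m)).2 : ℕ) := by
    intro m
    by_contra hlt
    have := hB (show ((k : ℕ) + m : ℤ) ∈ y ⁻¹' {x : Rays n | (x.2 : ℕ) < N} from not_le.1 hlt)
    omega
  have step : ∀ s, N ≤ ((y s).2 : ℕ) → (y (s + 1)).1 = (y s).1 ∧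
      ((y (s + 1)).2 : ℤ) = (y s).2 + t (y s).1 := fun s hs => by
    rw [← hstep]
    exact ht (y s).1 (y s).2 hs
  obtain ⟨r, hr⟩ : ∃ r, r = (y (k : ℕ)).1 := ⟨_, rfl⟩
  obtain ⟨l, hl⟩ : ∃ l, l = (y (k : ℕ)).2 := ⟨_, rfl⟩
  have hyk : y (k : ℕ) = (r, l) := Prod.ext hr.symm hl.symm
  have hlN : N ≤ (l : ℕ) := by
    have := hfar 0
    rwa [Nat.cast_zero, add_zero, ← hl] at this
  have horb : ∀ m : ℕ, (y ((k : ℕ) + m)).1 = r ∧ ((y ((k : ℕ) + m)).2 : ℤ) = l + m * t r := by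
    intro m
    induction m with
    | zero => simp [hyk]
    | succ m ih =>
      obtain ⟨h1, h2⟩ := step _ (hfar m)
      rw [ih.1, add_assoc] at h1 h2
      push_cast
      exact ⟨h1, by rw [h2, ih.2]; ring⟩
  -- A negative step would leave the ray, and a zero step would repeat a point.
  have htpos : 0 < t r := by
    rcases lt_trichotomy (t r) 0 with h0 | h0 | h0
    · have h1 := (horb l).2
      have h2 := (y ((k : ℕ) + (l : ℕ))).2.pos
      have h3 : ((l : ℕ) : ℤ) * t r ≤ (l : ℕ) * (-1) :=
        mul_le_mul_of_nonneg_left (by omega) (by omega)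
      omega
    · have h1 := horb 1
      rw [h0, mul_zero, add_zero] at h1
      have h2 : y ((k : ℕ) + (1 : ℕ)) = y (k : ℕ) := by
        rw [hyk]
        exact Prod.ext h1.1 (PNat.eq (by exact_mod_cast h1.2))
      have := hy h2
      omega
    · exact h0
  -- The neighbour `(r, l + 1)` is moved, hence on the orbit. It cannot precede `(r, l)`, since
  -- coordinates increase from there on; coming later, it forces the step to divide 1.
  obtain ⟨s, hs⟩ : (r, l + 1) ∈ Set.range y := by
    refine hmoved _ fun heq => ?_
    have := (ht r (l + 1) (by rw [PNat.add_coe]; omega)).2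
    rw [heq] at this
    dsimp only at this
    omega
  have hone : t r = 1 := by
    rcases le_or_gt ((k : ℕ) : ℤ) s with hks | hks
    · obtain ⟨m, rfl⟩ := Int.le.dest hks
      have h1 := (horb m).2
      rw [hs] at h1
      have h2 : (m : ℤ) * t r = 1 := by
        push_cast at h1
        omega
      exact Int.eq_one_of_mul_eq_one_left htpos.le h2
    · exfalso
      obtain ⟨m, hm⟩ := Int.le.dest hks.le
      have hback : ∀ m : ℕ, (y (s + m)).1 = r ∧ ((y (s + m)).2 : ℤ) = l + 1 + m * t r := by
        intro m
        induction m with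
        | zero => simp [hs]
        | succ m ih =>
          have hmt : 0 ≤ (m : ℤ) * t r := mul_nonneg (by omega) htpos.le
          obtain ⟨h1, h2⟩ := step (s + m) (by have := ih.2; omega)
          rw [ih.1, add_assoc] at h1 h2
          push_cast
          exact ⟨h1, by rw [h2, ih.2]; ring⟩
      have h1 := (hback m).2
      have hmt : 0 ≤ (m : ℤ) * t r := mul_nonneg (by omega) htpos.le
      rw [hm, hyk] at h1
      dsimp only at h1
      omega
  refine ⟨r, k, l, fun m => ⟨(horb m).1, ?_⟩⟩
  have := (horb m).2
  rw [hone, mul_one] at this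
  exact_mod_cast this

/-! ### The normalizer -/

theorem exists_ray_image {α : Equiv.Perm (Rays n)}
    (hα : α ∈ Subgroup.normalizer (houghton n : Set (Equiv.Perm (Rays n))))
    {i j : Fin n} (hij : i ≠ j) :
    ∃ (r : Fin n) (k l : ℕ+), ∀ m : ℕ, ∀ x y : ℕ+,
      (x : ℕ) = k + m → (y : ℕ) = l + m → α (i, x) = (r, y) := by
  have hmem := (Subgroup.mem_normalizer_iff.1 hα _).1 (rayShift_mem_houghton hij)
  obtain ⟨r, k, l, h⟩ := exists_ray_of_orbit hmem
    (y := fun s => α (rayLine hij s)) (α.injective.comp (rayLine hij).injective)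
    (fun s => by simp [rayShift_rayLine])
    (fun z hz => by
      by_contra hz'
      refine hz ?_
      rw [Equiv.Perm.mul_apply, Equiv.Perm.mul_apply, rayShift_of_notMem]
      · exact α.apply_symm_apply z
      rintro ⟨s, hs⟩
      exact hz' ⟨s, by simp [hs]⟩)
  refine ⟨r, k, l, fun m x y hx hy => ?_⟩
  obtain ⟨h1, h2⟩ := h m
  have e : (((k : ℕ) : ℤ) + m) = (x : ℕ) := by rw [hx]; push_cast; rfl
  rw [e, rayLine_of_pos] at h1 h2
  exact Prod.ext h1 (PNat.eq (h2.trans hy.symm))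

theorem exists_rayPerm_of_mem_normalizer (hn : 2 ≤ n) {α : Equiv.Perm (Rays n)}
    (hα : α ∈ Subgroup.normalizer (houghton n : Set (Equiv.Perm (Rays n)))) :
    ∃ π : Equiv.Perm (Fin n), ∀ i : Fin n, ∃ k l : ℕ+, ∀ m : ℕ, ∀ x y : ℕ+,
      (x : ℕ) = k + m → (y : ℕ) = l + m → α (i, x) = (π i, y) := by
  have : Nontrivial (Fin n) := Fin.nontrivial_iff_two_le.2 hn
  have key : ∀ i : Fin n, ∃ (r : Fin n) (k l : ℕ+), ∀ m : ℕ, ∀ x y : ℕ+,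
      (x : ℕ) = k + m → (y : ℕ) = l + m → α (i, x) = (r, y) := fun i => by
    obtain ⟨j, hj⟩ := exists_ne i
    exact exists_ray_image hα hj.symm
  choose π k l h using key
  have hπ : Function.Injective π := by
    intro i j hij
    -- Two tails mapped into the same ray would share the image point with coordinate `l i + l j`.
    have h1 := h i (l j) (k i + l j) (l i + l j) (PNat.add_coe _ _) (PNat.add_coe _ _)
    have h2 := h j (l i) (k j + l i) (l i + l j) (PNat.add_coe _ _)
      (by rw [PNat.add_coe, add_comm])
    rw [hij, ← h2] at h1
    exact congrArg Prod.fst (α.injective h1)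
  exact ⟨Equiv.ofBijective π (Finite.injective_iff_bijective.1 hπ), fun i => ⟨k i, l i, h i⟩⟩

theorem exists_eq_mul_rayPerm_of_mem_normalizer (hn : 2 ≤ n) {α : Equiv.Perm (Rays n)}
    (hα : α ∈ Subgroup.normalizer (houghton n : Set (Equiv.Perm (Rays n)))) :
    ∃ h ∈ houghton n, ∃ s : Equiv.Perm (Fin n), α = h * rayPerm n s := by
  obtain ⟨π, hπ⟩ := exists_rayPerm_of_mem_normalizer hn hα
  choose k l h using hπ
  refine ⟨α * (rayPerm n π)⁻¹, ?_, π, by simp⟩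
  refine ⟨Finset.univ.sup fun i => (k i : ℕ), fun i => (l (π⁻¹ i) : ℤ) - k (π⁻¹ i), ?_⟩
  intro i x hx
  have hk : (k (π⁻¹ i) : ℕ) ≤ x :=
    (Finset.le_sup (f := fun i => (k i : ℕ)) (Finset.mem_univ (π⁻¹ i))).trans hx
  obtain ⟨m, hm⟩ := Nat.exists_eq_add_of_le hk
  have e : (α * (rayPerm n π)⁻¹) (i, x) = α (π⁻¹ i, x) := rfl
  have hl := (l (π⁻¹ i)).pos
  rw [e, h (π⁻¹ i) m x ⟨l (π⁻¹ i) + m, by omega⟩ hm rfl]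
  refine ⟨π.apply_symm_apply i, ?_⟩
  rw [PNat.mk_coe, hm]
  push_cast
  ring

theorem eq_one_of_rayPerm_mem_houghton {s : Equiv.Perm (Fin n)} (hs : rayPerm n s ∈ houghton n) :
    s = 1 := by
  obtain ⟨N, t, h⟩ := hs
  exact Equiv.ext fun i => (h i ⟨N + 1, by omega⟩ (by rw [PNat.mk_coe]; omega)).1

theorem eq_one_of_commute_swap {X : Type*} [DecidableEq X] [Infinite X] {α : Equiv.Perm X}
    (h : ∀ a b : X, α * Equiv.swap a b * α⁻¹ = Equiv.swap a b) : α = 1 := by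
  have := eq_of_swap_eq_swap α.injective (g := id) fun a b _ => by
    rw [Equiv.swap_apply_apply, h]; rfl
  exact Equiv.ext fun x => congrFun this x

/-! ### The isomorphism -/

theorem conj_comp_rayAction (s : Equiv.Perm (Fin n)) :
    (MulAut.conj : houghton n →* _).comp (rayAction n s).toMonoidHom
      = (MulAut.conj (rayAction n s)).toMonoidHom.comp MulAut.conj := by
  refine MonoidHom.ext fun h => MulEquiv.ext fun g => ?_
  change rayAction n s h * g * (rayAction n s h)⁻¹
    = rayAction n s (h * (rayAction n s)⁻¹ g * h⁻¹)
  rw [map_mul, map_mul, map_inv, MulAut.apply_inv_self]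

/-- The homomorphism that sends an element of the Houghton group, and a permutation of the rays,
to the respective conjugation. -/
def houghtonAutHom (n : ℕ) : houghton n ⋊[rayAction n] Equiv.Perm (Fin n) →* MulAut (houghton n) :=
  SemidirectProduct.lift MulAut.conj (rayAction n) conj_comp_rayAction

theorem houghtonAutHom_apply (p : houghton n ⋊[rayAction n] Equiv.Perm (Fin n))
    (g : houghton n) : (houghtonAutHom n p g : Equiv.Perm (Rays n)) =
      (p.left * rayPerm n p.right) * g * (p.left * rayPerm n p.right : Equiv.Perm (Rays n))⁻¹ := by
  change (p.left : Equiv.Perm (Rays n)) * (rayAction n p.right g : Equiv.Perm (Rays n))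
    * (p.left : Equiv.Perm (Rays n))⁻¹ = _
  rw [rayAction_apply, mul_inv_rev]
  simp only [mul_assoc]

theorem houghtonAutHom_bijective (hn : 2 ≤ n) : Function.Bijective (houghtonAutHom n) := by
  have : NeZero n := ⟨by omega⟩
  constructor
  · rw [injective_iff_map_eq_one]
    intro p hp
    have h1 : (p.left * rayPerm n p.right : Equiv.Perm (Rays n)) = 1 := by
      refine eq_one_of_commute_swap fun a b => ?_
      have := houghtonAutHom_apply p ⟨Equiv.swap a b, swap_mem_houghton a b⟩
      rw [hp] at this
      exact this.symm
    have h2 : p.right = 1 := eq_one_of_rayPerm_mem_houghton (by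
      rw [← inv_eq_of_mul_eq_one_right h1]
      exact (houghton n).inv_mem p.left.2)
    rw [h2, map_one, mul_one] at h1
    exact SemidirectProduct.ext (Subtype.ext h1) h2
  · intro φ
    obtain ⟨α, hα⟩ := exists_perm_conj_eq swap_mem_houghton φ
    have hnorm : α ∈ Subgroup.normalizer (houghton n : Set (Equiv.Perm (Rays n))) := by
      refine Subgroup.mem_normalizer_iff.2 fun g => ⟨fun hg => ?_, fun hg => ?_⟩
      · rw [← hα ⟨g, hg⟩]
        exact (φ ⟨g, hg⟩).2
      · obtain ⟨g', hg'⟩ := φ.surjective ⟨_, hg⟩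
        have h1 := hα g'
        rw [hg'] at h1
        have h2 : g = g' := mul_left_cancel (mul_right_cancel h1)
        rw [h2]
        exact g'.2
    obtain ⟨h, hh, s, rfl⟩ := exists_eq_mul_rayPerm_of_mem_normalizer hn hnorm
    refine ⟨⟨⟨h, hh⟩, s⟩, MulEquiv.ext fun g => Subtype.ext ?_⟩
    rw [houghtonAutHom_apply, hα]

end Houghton

theorem mainTheorem2 (n : ℕ) (hn : 2 ≤ n) :
    (∃ e : houghton n ⋊[rayAction n] Equiv.Perm (Fin n) ≃* MulAut (houghton n),
      (∀ h : houghton n, e (SemidirectProduct.inl h) = MulAut.conj h) ∧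
      (∀ s : Equiv.Perm (Fin n), e (SemidirectProduct.inr s) = rayAction n s)) ∧
    (∀ α ∈ Subgroup.normalizer (houghton n : Set (Equiv.Perm (Rays n))),
      ∃ π : Equiv.Perm (Fin n), ∀ i : Fin n, ∃ k l : ℕ+, ∀ m : ℕ, ∀ x y : ℕ+,
        (x : ℕ) = k + m → (y : ℕ) = l + m → α (i, x) = (π i, y)) :=
  ⟨⟨MulEquiv.ofBijective (houghtonAutHom n) (houghtonAutHom_bijective hn),
    fun _ => SemidirectProduct.lift_inl _ _ conj_comp_rayAction _, fun _ => SemidirectProduct.lift_inr _ _ conj_comp_rayAction _⟩,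
    fun _ => exists_rayPerm_of_mem_normalizer hn⟩
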